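/- Fix a set of actions, ranged over by $\alpha$. \emph{Finite processes} are the terms $F ::= 0 \mid \alpha.F \mid F|F$, and \emph{processes} are the terms $P ::= F \mid\, !\alpha.F \mid P|P$. Transitions are given by the rules: $\alpha.F \xrightarrow{\alpha} F$; $\;!\alpha.F \xrightarrow{\alpha}\, !\alpha.F\,|\,F$; if $P\xrightarrow{\alpha}P'$ then $P|Q\xrightarrow{\alpha}P'|Q$ and $Q|P\xrightarrow{\alpha}Q|P'$ (there is no synchronisation). Let $\sim$ be strong bisimilarity for this transition system. Let $\equiv_D$ be the smallest congruence on processes (that is, the smallest equivalence relation preserved by parallel composition, by prefixing $F\mapsto\alpha.F$ and by replicated prefixing $F\mapsto\,!\alpha.F$ on finite processes) containing the abelian monoid laws for $|$ with neutral element $0$, and the distribution law $\alpha.(F\,|\,\alpha.F\,|\dots|\,\alpha.F) = \alpha.F\,|\,\alpha.F\,|\dots|\,\alpha.F$, with as many occurrences of $F$ on both sides, for every action $\alpha$ and finite process $F$. The \emph{size} of a process is the number of prefixes (replicated or not) occurring in it. A \emph{seed} of a process $Q$ is a process of minimal size among the processes bisimilar to $Q$; a process is a \emph{seed} if it is a seed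 of some process. \textbf{Proposition (Uniqueness of seeds).} If $P$ and $P'$ are seeds and $P\sim P'$, then $P\equiv_D P'$. -/

import Mathlib

universe u

namespace MiniCCS

/-- Finite processes: `F ::= 0 | α.F | F|F`. -/
inductive FinProc (Act : Type u) : Type u
  | nil : FinProc Act
  | pre (a : Act) (F : FinProc Act) : FinProc Act
  | par (F G : FinProc Act) : FinProc Act

/-- Processes: `P ::= F | !α.F | P|P`, with `F` finite. Since a parallel composition of finite
processes is the same term whether it is read as an `F` or as a `P|P`, the terms of this grammar
are exactly those built from `0`, `α.F`, `!α.F` and parallel composition. -/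
inductive Proc (Act : Type u) : Type u
  | nil : Proc Act
  | pre (a : Act) (F : FinProc Act) : Proc Act
  | bang (a : Act) (F : FinProc Act) : Proc Act
  | par (P Q : Proc Act) : Proc Act

variable {Act : Type u}

/-- The number of prefixes of a finite process. -/
def FinProc.size : FinProc Act → ℕ
  | .nil => 0
  | .pre _ F => F.size + 1
  | .par F G => F.size + G.size

/-- The inclusion of finite processes into processes. -/
def FinProc.toProc : FinProc Act → Proc Act
  | .nil => .nil
  | .pre a F => .pre a F
  | .par F G => .par F.toProc G.toProc

instance : Coe (FinProc Act) (Proc Act) := ⟨FinProc.toProc⟩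

/-- The parallel composition of `n` copies of `F` (and `0` if `n = 0`). -/
def FinProc.copies (F : FinProc Act) : ℕ → FinProc Act
  | 0 => .nil
  | n + 1 => .par F (F.copies n)

/-- The size of a process: its number of prefixes (a replicated prefix counts once). -/
def Proc.size : Proc Act → ℕ
  | .nil => 0
  | .pre _ F => F.size + 1
  | .bang _ F => F.size + 1
  | .par P Q => P.size + Q.size

/-- The labelled transition system (without synchronisation). -/
inductive Step : Proc Act → Act → Proc Act → Prop
  | pre (a : Act) (F : FinProc Act) : Step (.pre a F) a F
  | bang (a : Act) (F : FinProc Act) : Step (.bang a F) a (.par (.bang a F) F)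
  | parL {a : Act} {P P' : Proc Act} (Q : Proc Act) :
      Step P a P' → Step (.par P Q) a (.par P' Q)
  | parR {a : Act} (P : Proc Act) {Q Q' : Proc Act} :
      Step Q a Q' → Step (.par P Q) a (.par P Q')

/-- `R` is a strong bisimulation. -/
def IsBisimulation (R : Proc Act → Proc Act → Prop) : Prop :=
  ∀ P Q, R P Q → ∀ a,
    (∀ P', Step P a P' → ∃ Q', Step Q a Q' ∧ R P' Q') ∧
    (∀ Q', Step Q a Q' → ∃ P', Step P a P' ∧ R P' Q')

/-- Strong bisimilarity `P ∼ Q`. -/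
def Bisim (P Q : Proc Act) : Prop :=
  ∃ R : Proc Act → Proc Act → Prop, IsBisimulation R ∧ R P Q

/-- The smallest congruence on processes containing the abelian monoid laws for `(|, 0)` and the
distribution law `α.(F | α.F | … | α.F) = α.F | α.F | … | α.F` (`n` copies of `α.F` inside the
prefix on the left, `n + 1` copies on the right). -/
inductive EqD : Proc Act → Proc Act → Prop
  | refl (P : Proc Act) : EqD P P
  | symm {P Q : Proc Act} : EqD P Q → EqD Q P
  | trans {P Q R : Proc Act} : EqD P Q → EqD Q R → EqD P R
  | pre (a : Act) {F G : FinProc Act} : EqD (F : Proc Act) (G : Proc Act) →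
      EqD (.pre a F) (.pre a G)
  | bang (a : Act) {F G : FinProc Act} : EqD (F : Proc Act) (G : Proc Act) →
      EqD (.bang a F) (.bang a G)
  | par {P P' Q Q' : Proc Act} : EqD P P' → EqD Q Q' → EqD (.par P Q) (.par P' Q')
  | par_nil (P : Proc Act) : EqD (.par P .nil) P
  | par_comm (P Q : Proc Act) : EqD (.par P Q) (.par Q P)
  | par_assoc (P Q R : Proc Act) : EqD (.par (.par P Q) R) (.par P (.par Q R))
  | distrib (a : Act) (F : FinProc Act) (n : ℕ) :
      EqD (.pre a (.par F ((FinProc.pre a F).copies n)))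
        (((FinProc.pre a F).copies (n + 1) : FinProc Act) : Proc Act)

/-- `S` is a seed of `P`: a process of minimal size among the processes bisimilar to `P`. -/
def IsSeedOf (S P : Proc Act) : Prop :=
  Bisim P S ∧ ∀ Q : Proc Act, Bisim P Q → S.size ≤ Q.size

/-- `S` is a seed (of some process). -/
def IsSeed (S : Proc Act) : Prop :=
  ∃ P : Proc Act, IsSeedOf S P

end MiniCCS

/-! Work in the commutative monoid of behaviours, that is, processes up to bisimilarity under
parallel composition. Up to the monoid laws a process is a pair: a multiset `s` of replicated
prefixes and a finite process `F`. Two facts about finite and replicated behaviours carry the proof.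

Finite behaviours decompose uniquely into indecomposables (`unique_decomposition`), in the style of
Milner and Moller. A prefix has a single derivative, so it is a multiple `(k + 1) • b.H` of one
indecomposable. This is exactly an instance of the distribution law, which is therefore complete for
bisimilarity of finite processes (`eqD_of_fbeh_eq`).

Unique decomposition fails with replication, since `!a.F | a.F ∼ !a.F`. Equality modulo `bangs s`
takes its place. Minimality of a seed forces `F` and all replicated bodies to be reduced, meaning
that no prefixed subterm is absorbed by `bangs s`; for reduced processes, equality modulo `bangs s`
is plain bisimilarity (`fbeh_eq_of_reduced`). Two bisimilar seeds have bisimilar replicated parts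
(`MinimalPair.bangs_eq`), hence the same bodies up to bisimilarity, without repetition by
minimality, and the same finite part. Completeness for finite processes then finishes the argument.
-/

namespace MiniCCS

/-! ### Unique decomposition in interleaving monoids -/

section UniqueDecomposition

variable {M : Type*} {A : Type*} [AddCommMonoid M]

/-- An indecomposable element of an additive monoid. -/
def Indecomposable (p : M) : Prop :=
  p ≠ 0 ∧ ∀ x y, p = x + y → x = 0 ∨ y = 0

/-- A transition relation on a commutative monoid in which sums interleave, every transition
decreases the size by one, and only `0` is inert. -/
structure IsInterleaving (T : M → A → M → Prop) (sz : M → ℕ) : Prop where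
  sz_add : ∀ x y, sz (x + y) = sz x + sz y
  sz_step : ∀ {x a y}, T x a y → sz x = sz y + 1
  exists_step : ∀ {x}, x ≠ 0 → ∃ a y, T x a y
  step_add : ∀ {x y a z}, T (x + y) a z ↔
    (∃ x', T x a x' ∧ z = x' + y) ∨ ∃ y', T y a y' ∧ z = x + y'

namespace IsInterleaving

variable {T : M → A → M → Prop} {sz : M → ℕ}

theorem sz_zero (h : IsInterleaving T sz) : sz 0 = 0 := by
  have := h.sz_add 0 0
  rw [add_zero] at this
  omega

theorem not_step_zero (h : IsInterleaving T sz) {a : A} {z : M} : ¬ T 0 a z := fun hT => by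
  have := h.sz_step hT
  rw [h.sz_zero] at this
  omega

theorem sz_pos (h : IsInterleaving T sz) {x : M} (hx : x ≠ 0) : 0 < sz x := by
  obtain ⟨a, y, hT⟩ := h.exists_step hx
  have := h.sz_step hT
  omega

theorem exists_decomposition (h : IsInterleaving T sz) (x : M) :
    ∃ s : Multiset M, (∀ p ∈ s, Indecomposable p) ∧ s.sum = x := by
  induction hn : sz x using Nat.strong_induction_on generalizing x with
  | _ n ih =>
    by_cases hx0 : x = 0
    · exact ⟨0, by simp, by simp [hx0]⟩
    by_cases hx : Indecomposable x
    · exact ⟨{x}, by simpa using hx, by simp⟩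
    obtain ⟨y, z, hyz, hy, hz⟩ : ∃ y z, x = y + z ∧ y ≠ 0 ∧ z ≠ 0 := by
      by_contra hcon
      push Not at hcon
      exact hx ⟨hx0, fun y z hyz => or_iff_not_imp_left.2 fun hy => hcon y z hyz hy⟩
    have h1 := h.sz_pos hy
    have h2 := h.sz_pos hz
    have h3 := h.sz_add y z
    rw [← hyz] at h3
    obtain ⟨s, hs, hs'⟩ := ih (sz y) (by omega) y rfl
    obtain ⟨t, ht, ht'⟩ := ih (sz z) (by omega) z rfl
    refine ⟨s + t, fun p hp => ?_, by rw [Multiset.sum_add, hs', ht', hyz]⟩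
    exact (Multiset.mem_add.1 hp).elim (hs p) (ht p)

theorem sz_le_of_mem (h : IsInterleaving T sz) {s : Multiset M} {p : M} (hp : p ∈ s) :
    sz p ≤ sz s.sum := by
  obtain ⟨t, rfl⟩ := Multiset.exists_cons_of_mem hp
  rw [Multiset.sum_cons, h.sz_add]
  omega

theorem card_le_sz (h : IsInterleaving T sz) {s : Multiset M}
    (hs : ∀ p ∈ s, Indecomposable p) : s.card ≤ sz s.sum := by
  induction s using Multiset.induction_on with
  | empty => simp
  | cons p s ih =>
    have h1 := ih fun q hq => hs q (Multiset.mem_cons_of_mem hq)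
    have h2 := h.sz_pos (hs p (Multiset.mem_cons_self p s)).1
    rw [Multiset.sum_cons, h.sz_add, Multiset.card_cons]
    omega

open Classical in
theorem step_sum_of_mem (h : IsInterleaving T sz) {s : Multiset M} {r r' : M} {a : A}
    (hr : r ∈ s) (hT : T r a r') : T s.sum a ((s.erase r).sum + r') := by
  have hs : s.sum = r + (s.erase r).sum := by rw [← Multiset.sum_cons, Multiset.cons_erase hr]
  rw [hs]
  exact h.step_add.2 (Or.inl ⟨r', hT, add_comm _ _⟩)

open Classical in
theorem exists_mem_of_step_sum (h : IsInterleaving T sz) {s : Multiset M} {z : M} {a : A}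
    (hT : T s.sum a z) : ∃ r ∈ s, ∃ r', T r a r' ∧ z = (s.erase r).sum + r' := by
  induction s using Multiset.induction_on generalizing z with
  | empty => exact (h.not_step_zero hT).elim
  | cons p s ih =>
    rw [Multiset.sum_cons] at hT
    rcases h.step_add.1 hT with ⟨p', hp', rfl⟩ | ⟨y, hy, rfl⟩
    · exact ⟨p, Multiset.mem_cons_self p s, p', hp', by
        rw [Multiset.erase_cons_head, add_comm]⟩
    · obtain ⟨r, hr, r', hr', rfl⟩ := ih hy
      refine ⟨r, Multiset.mem_cons_of_mem hr, r', hr', ?_⟩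
      rw [Multiset.erase_cons_tail_of_mem hr, Multiset.sum_cons, add_assoc]

/-- A chosen decomposition into indecomposables. -/
noncomputable def factors (h : IsInterleaving T sz) (x : M) : Multiset M :=
  (h.exists_decomposition x).choose

theorem indecomposable_of_mem_factors (h : IsInterleaving T sz) {x p : M}
    (hp : p ∈ h.factors x) : Indecomposable p :=
  (h.exists_decomposition x).choose_spec.1 p hp

theorem sum_factors (h : IsInterleaving T sz) (x : M) : (h.factors x).sum = x :=
  (h.exists_decomposition x).choose_spec.2

open Classical in
theorem count_factors_eq_zero (h : IsInterleaving T sz) {x p : M} (hlt : sz x < sz p) :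
    (h.factors x).count p = 0 := by
  rw [Multiset.count_eq_zero]
  intro hp
  have := h.sz_le_of_mem hp
  rw [h.sum_factors] at this
  omega

/-- Uniqueness of decompositions of elements of size less than `n`. -/
def UniqueBelow (_ : IsInterleaving T sz) (n : ℕ) : Prop :=
  ∀ s t : Multiset M, (∀ p ∈ s, Indecomposable p) → (∀ p ∈ t, Indecomposable p) →
    s.sum = t.sum → sz s.sum < n → s = t

-- A transition lowers the size, so the two residuals lie below the bound `n`, where decompositions
-- are already known to be unique.
open Classical in
theorem erase_add_factors_eq (h : IsInterleaving T sz) {n : ℕ} (hu : h.UniqueBelow n)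
    {s t : Multiset M} (hs : ∀ p ∈ s, Indecomposable p) (ht : ∀ p ∈ t, Indecomposable p)
    {r r' q q' : M} {a : A} (hn : sz s.sum ≤ n) (hr : r ∈ s) (hT : T r a r')
    (heq : (s.erase r).sum + r' = (t.erase q).sum + q') :
    s.erase r + h.factors r' = t.erase q + h.factors q' := by
  have hlt := h.sz_step (h.step_sum_of_mem hr hT)
  refine hu _ _ (fun p hp => ?_) (fun p hp => ?_) ?_ ?_
  · exact (Multiset.mem_add.1 hp).elim (fun h' => hs p (Multiset.mem_of_mem_erase h'))
      h.indecomposable_of_mem_factors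
  · exact (Multiset.mem_add.1 hp).elim (fun h' => ht p (Multiset.mem_of_mem_erase h'))
      h.indecomposable_of_mem_factors
  · rw [Multiset.sum_add, Multiset.sum_add, h.sum_factors, h.sum_factors, heq]
  · rw [Multiset.sum_add, h.sum_factors]
    omega

open Classical in
/-- Each transition of `s.sum` is matched by one of `t.sum`, with the same factors left. -/
theorem exists_matching_step (h : IsInterleaving T sz) {n : ℕ} (hu : h.UniqueBelow n)
    {s t : Multiset M} (hs : ∀ p ∈ s, Indecomposable p) (ht : ∀ p ∈ t, Indecomposable p)
    (heq : s.sum = t.sum) (hn : sz s.sum ≤ n) {r r' : M} {a : A} (hr : r ∈ s) (hT : T r a r') :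
    ∃ q ∈ t, ∃ q', T q a q' ∧ s.erase r + h.factors r' = t.erase q + h.factors q' := by
  have hstep := h.step_sum_of_mem hr hT
  rw [heq] at hstep
  obtain ⟨q, hq, q', hq', hz⟩ := h.exists_mem_of_step_sum hstep
  exact ⟨q, hq, q', hq', h.erase_add_factors_eq hu hs ht hn hr hT hz⟩

-- If `p` is more frequent in `s` than in `t`, matching transitions of the two sums expose the
-- discrepancy. When some factor is larger than `p`, the surplus of `p` must be compensated by
-- derivatives with ever more factors `p`, which their size forbids. Otherwise no derivative of a
-- factor has `p` as a factor, and counting `p` forces `s = {p}`, against indecomposability of `p`.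
open Classical in
theorem not_count_lt_of_maximal (h : IsInterleaving T sz) {n : ℕ} (hu : h.UniqueBelow n)
    {s t : Multiset M} (hs : ∀ p ∈ s, Indecomposable p) (ht : ∀ p ∈ t, Indecomposable p)
    (heq : s.sum = t.sum) (hn : sz s.sum ≤ n) {p : M}
    (hmax : ∀ q, sz p < sz q → s.count q = t.count q) : ¬ t.count p < s.count p := by
  intro hlt
  have hmem : ∀ q, sz p < sz q → (q ∈ s ↔ q ∈ t) := fun q hq => by
    rw [← Multiset.count_pos, ← Multiset.count_pos, hmax q hq]
  by_cases hbig : ∃ r ∈ s, sz p < sz r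
  -- The matching move of `t` must make up for its missing copy of `p`, so its derivative has one
  -- more factor `p`. The factor that moves is then larger than `p`, hence also lies in `s`, and the
  -- argument repeats.
  · have key : ∀ k, ∃ r ∈ s, ∃ a r', sz p < sz r ∧ T r a r' ∧
        k ≤ (h.factors r').count p := by
      intro k
      induction k with
      | zero =>
        obtain ⟨r, hr, hpr⟩ := hbig
        obtain ⟨a, r', hT⟩ := h.exists_step (hs r hr).1
        exact ⟨r, hr, a, r', hpr, hT, Nat.zero_le _⟩
      | succ k ih =>
        obtain ⟨r, hr, a, r', hpr, hT, hk⟩ := ih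
        obtain ⟨q, hq, q', hT', he⟩ := h.exists_matching_step hu hs ht heq hn hr hT
        have hc := congrArg (Multiset.count p) he
        rw [Multiset.count_add, Multiset.count_add,
          Multiset.count_erase_of_ne (by rintro rfl; omega)] at hc
        have hle : (t.erase q).count p ≤ t.count p :=
          Multiset.count_le_of_le p (Multiset.erase_le q t)
        have hpq : sz p < sz q := by
          by_contra hcon
          have := h.sz_step hT'
          have := h.count_factors_eq_zero (x := q') (p := p) (by omega)
          omega
        exact ⟨q, (hmem q hpq).2 hq, a, q', hpq, hT', by omega⟩
    obtain ⟨r, hr, a, r', -, hT, hk⟩ := key (sz s.sum)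
    have h1 := h.sz_le_of_mem hr
    have h2 := h.sz_step hT
    have h3 := h.card_le_sz (s := h.factors r') fun q hq => h.indecomposable_of_mem_factors hq
    have h4 := Multiset.count_le_card p (h.factors r')
    rw [h.sum_factors] at h3
    omega
  · push Not at hbig
    have hbig' : ∀ r ∈ t, sz r ≤ sz p := fun r hr => by
      by_contra hcon
      push Not at hcon
      have := hbig r ((hmem r hcon).2 hr)
      omega
    have hzero : ∀ r r' a, sz r ≤ sz p → T r a r' → (h.factors r').count p = 0 := by
      intro r r' a hr hT
      have := h.sz_step hT
      exact h.count_factors_eq_zero (by omega)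
    -- Moving some `q ≠ p` would keep every copy of `p` in `s`, while the matching residual of `t`
    -- has at most `t.count p` copies.
    have hall : ∀ q ∈ s, q = p := by
      intro q hq
      by_contra hqp
      obtain ⟨a, q', hT⟩ := h.exists_step (hs q hq).1
      obtain ⟨r, hr, r', hT', he⟩ := h.exists_matching_step hu hs ht heq hn hq hT
      have hc := congrArg (Multiset.count p) he
      rw [Multiset.count_add, Multiset.count_add, hzero _ _ _ (hbig q hq) hT,
        hzero _ _ _ (hbig' r hr) hT', Multiset.count_erase_of_ne (Ne.symm hqp)] at hc
      have hle : (t.erase r).count p ≤ t.count p :=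
        Multiset.count_le_of_le p (Multiset.erase_le r t)
      omega
    have hps : p ∈ s := Multiset.count_pos.1 (by omega)
    -- Conversely, any move of `t` is answered by consuming a copy of `p`, the only factor available
    -- in `s`.
    have hmatch : ∀ q ∈ t, (t.erase q).count p + 1 = s.count p := by
      intro q hq
      obtain ⟨a, q', hT⟩ := h.exists_step (ht q hq).1
      obtain ⟨r, hr, r', hT', he⟩ :=
        h.exists_matching_step hu ht hs heq.symm (heq ▸ hn) hq hT
      obtain rfl := hall r hr
      have hc := congrArg (Multiset.count r) he
      rw [Multiset.count_add, Multiset.count_add, hzero _ _ _ (hbig' q hq) hT,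
        hzero _ _ _ le_rfl hT', Multiset.count_erase_self] at hc
      omega
    have hpt : p ∉ t := fun hp => by
      have := hmatch p hp
      rw [Multiset.count_erase_self] at this
      have := Multiset.count_pos.2 hp
      omega
    obtain ⟨s', rfl⟩ := Multiset.exists_cons_of_mem hps
    have hne : t ≠ 0 := by
      rintro rfl
      have h1 := h.sz_le_of_mem hps
      rw [heq, Multiset.sum_zero, h.sz_zero] at h1
      have := h.sz_pos (hs p hps).1
      omega
    obtain ⟨q, hq⟩ := Multiset.exists_mem_of_ne_zero hne
    have hqp : p ≠ q := fun hpq => hpt (hpq ▸ hq)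
    have h1 := hmatch q hq
    rw [Multiset.count_erase_of_ne hqp, Multiset.count_eq_zero.2 hpt,
      Multiset.count_cons_self] at h1
    have hs' : s' = 0 := Multiset.eq_zero_of_forall_notMem fun r hr => by
      have := hall r (Multiset.mem_cons_of_mem hr)
      subst this
      have := Multiset.count_pos.2 hr
      omega
    obtain ⟨t', rfl⟩ := Multiset.exists_cons_of_mem hq
    rw [hs', Multiset.sum_cons, Multiset.sum_zero, add_zero, Multiset.sum_cons] at heq
    rcases (hs p hps).2 _ _ heq with h0 | h0
    · exact (ht q hq).1 h0
    · rw [h0, add_zero] at heq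
      exact hqp heq

/-- Two different decompositions would have a largest element whose multiplicities differ; neither
multiplicity can exceed the other. -/
theorem uniqueBelow (h : IsInterleaving T sz) (n : ℕ) : h.UniqueBelow n := by
  classical
  induction n with
  | zero => exact fun s t _ _ _ hlt => (Nat.not_lt_zero _ hlt).elim
  | succ n ih =>
    intro s t hs ht heq hlt
    by_contra hne
    have hex : ((s + t).toFinset.filter fun p => s.count p ≠ t.count p).Nonempty := by
      by_contra hcon
      rw [Finset.not_nonempty_iff_eq_empty, Finset.filter_eq_empty_iff] at hcon
      refine hne (Multiset.ext.2 fun p => ?_)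
      by_cases hp : p ∈ s + t
      · exact not_not.1 (hcon (Multiset.mem_toFinset.2 hp))
      · rw [Multiset.mem_add, not_or] at hp
        rw [Multiset.count_eq_zero.2 hp.1, Multiset.count_eq_zero.2 hp.2]
    obtain ⟨p, hp, hmax⟩ := Finset.exists_max_image _ sz hex
    have hmax' : ∀ q, sz p < sz q → s.count q = t.count q := by
      intro q hq
      by_contra hcon
      have hmem : q ∈ s + t := by
        rw [← Multiset.count_pos, Multiset.count_add]
        omega
      have := hmax q (Finset.mem_filter.2 ⟨Multiset.mem_toFinset.2 hmem, hcon⟩)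
      omega
    have h1 := h.not_count_lt_of_maximal ih hs ht heq (by omega) hmax'
    have h2 := h.not_count_lt_of_maximal ih ht hs heq.symm (by rw [← heq]; omega)
      fun q hq => (hmax' q hq).symm
    exact (Finset.mem_filter.1 hp).2 (by omega)

/-- Unique decomposition into indecomposables. -/
theorem unique_decomposition (h : IsInterleaving T sz) {s t : Multiset M}
    (hs : ∀ p ∈ s, Indecomposable p) (ht : ∀ p ∈ t, Indecomposable p)
    (heq : s.sum = t.sum) : s = t :=
  h.uniqueBelow (sz s.sum + 1) s t hs ht heq (Nat.lt_succ_self _)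

/-- An element all of whose transitions have the same target is a multiple of an
indecomposable element. -/
theorem exists_nsmul_of_step_unique (h : IsInterleaving T sz) {x : M} (hx : x ≠ 0)
    (hT : ∀ a y b z, T x a y → T x b z → y = z) :
    ∃ p k, Indecomposable p ∧ x = (k + 1) • p := by
  classical
  obtain ⟨s, hs, rfl⟩ := h.exists_decomposition x
  have hne : s.toFinset.Nonempty := by
    rw [Multiset.toFinset_nonempty]
    rintro rfl
    exact hx Multiset.sum_zero
  obtain ⟨p, hp, hmax⟩ := Finset.exists_max_image _ sz hne
  rw [Multiset.mem_toFinset] at hp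
  -- Here `p` is a factor of maximal size, so it is not a factor of any derivative of a factor.
  -- Moving `p` loses one copy of `p` and moving `q ≠ p` loses none, yet the two residuals coincide.
  have hall : ∀ q ∈ s, q = p := by
    intro q hq
    by_contra hqp
    obtain ⟨a, p', hp'⟩ := h.exists_step (hs p hp).1
    obtain ⟨b, q', hq'⟩ := h.exists_step (hs q hq).1
    have he := h.erase_add_factors_eq (h.uniqueBelow (sz s.sum)) hs hs le_rfl hp hp'
      (hT _ _ _ _ (h.step_sum_of_mem hp hp') (h.step_sum_of_mem hq hq'))
    have hc := congrArg (Multiset.count p) he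
    have h1 := h.sz_step hp'
    have h2 := h.sz_step hq'
    have h3 := hmax q (Multiset.mem_toFinset.2 hq)
    rw [Multiset.count_add, Multiset.count_add, h.count_factors_eq_zero (by omega),
      h.count_factors_eq_zero (by omega), Multiset.count_erase_self,
      Multiset.count_erase_of_ne (Ne.symm hqp)] at hc
    have := Multiset.count_pos.2 hp
    omega
  refine ⟨p, s.card - 1, hs p hp, ?_⟩
  have hcard : 0 < s.card := Multiset.card_pos_iff_exists_mem.2 ⟨p, hp⟩
  rw [Nat.sub_add_cancel hcard]
  conv_lhs => rw [Multiset.eq_replicate_card.2 hall, Multiset.sum_replicate]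

end IsInterleaving

end UniqueDecomposition

variable {Act : Type u}

/-! ### Bisimilarity and the monoid of behaviours -/

theorem isBisimulation_bisim : IsBisimulation (Bisim (Act := Act)) := by
  rintro P Q ⟨R, hR, hPQ⟩ a
  constructor
  · intro P' hP
    obtain ⟨Q', hQ, h⟩ := (hR P Q hPQ a).1 P' hP
    exact ⟨Q', hQ, R, hR, h⟩
  · intro Q' hQ
    obtain ⟨P', hP, h⟩ := (hR P Q hPQ a).2 Q' hQ
    exact ⟨P', hP, R, hR, h⟩

theorem Bisim.refl (P : Proc Act) : Bisim P P := by
  refine ⟨Eq, ?_, rfl⟩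
  rintro P _ rfl a
  exact ⟨fun P' h => ⟨P', h, rfl⟩, fun P' h => ⟨P', h, rfl⟩⟩

theorem Bisim.symm {P Q : Proc Act} (h : Bisim P Q) : Bisim Q P :=
  ⟨fun X Y => Bisim Y X, fun X Y hXY a =>
    ⟨(isBisimulation_bisim Y X hXY a).2, (isBisimulation_bisim Y X hXY a).1⟩, h⟩

theorem Bisim.trans {P Q R : Proc Act} (h : Bisim P Q) (h' : Bisim Q R) : Bisim P R := by
  refine ⟨fun X Z => ∃ Y, Bisim X Y ∧ Bisim Y Z, ?_, Q, h, h'⟩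
  rintro X Z ⟨Y, hXY, hYZ⟩ a
  constructor
  · intro X' hX
    obtain ⟨Y', hY, h1⟩ := (isBisimulation_bisim _ _ hXY a).1 X' hX
    obtain ⟨Z', hZ, h2⟩ := (isBisimulation_bisim _ _ hYZ a).1 Y' hY
    exact ⟨Z', hZ, Y', h1, h2⟩
  · intro Z' hZ
    obtain ⟨Y', hY, h2⟩ := (isBisimulation_bisim _ _ hYZ a).2 Z' hZ
    obtain ⟨X', hX, h1⟩ := (isBisimulation_bisim _ _ hXY a).2 Y' hY
    exact ⟨X', hX, Y', h1, h2⟩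

theorem step_par_iff {P Q R : Proc Act} {a : Act} : Step (.par P Q) a R ↔
    (∃ P', Step P a P' ∧ R = .par P' Q) ∨ ∃ Q', Step Q a Q' ∧ R = .par P Q' := by
  constructor
  · intro h
    cases h with
    | parL _ h => exact Or.inl ⟨_, h, rfl⟩
    | parR _ h => exact Or.inr ⟨_, h, rfl⟩
  · rintro (⟨P', h, rfl⟩ | ⟨Q', h, rfl⟩)
    · exact .parL _ h
    · exact .parR _ h

theorem not_step_nil {a : Act} {P : Proc Act} : ¬ Step .nil a P := nofun

theorem Bisim.par {P P' Q Q' : Proc Act} (hP : Bisim P P') (hQ : Bisim Q Q') :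
    Bisim (.par P Q) (.par P' Q') := by
  refine ⟨fun X Y => ∃ P P' Q Q', X = .par P Q ∧ Y = .par P' Q' ∧ Bisim P P' ∧ Bisim Q Q',
    ?_, P, P', Q, Q', rfl, rfl, hP, hQ⟩
  rintro _ _ ⟨P, P', Q, Q', rfl, rfl, hP, hQ⟩ a
  constructor
  · intro X hX
    rcases step_par_iff.1 hX with ⟨R, hR, rfl⟩ | ⟨R, hR, rfl⟩
    · obtain ⟨R', hR', h⟩ := (isBisimulation_bisim _ _ hP a).1 R hR
      exact ⟨_, .parL _ hR', _, _, _, _, rfl, rfl, h, hQ⟩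
    · obtain ⟨R', hR', h⟩ := (isBisimulation_bisim _ _ hQ a).1 R hR
      exact ⟨_, .parR _ hR', _, _, _, _, rfl, rfl, hP, h⟩
  · intro X hX
    rcases step_par_iff.1 hX with ⟨R, hR, rfl⟩ | ⟨R, hR, rfl⟩
    · obtain ⟨R', hR', h⟩ := (isBisimulation_bisim _ _ hP a).2 R hR
      exact ⟨_, .parL _ hR', _, _, _, _, rfl, rfl, h, hQ⟩
    · obtain ⟨R', hR', h⟩ := (isBisimulation_bisim _ _ hQ a).2 R hR
      exact ⟨_, .parR _ hR', _, _, _, _, rfl, rfl, hP, h⟩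

theorem bisim_par_nil (P : Proc Act) : Bisim (.par P .nil) P := by
  refine ⟨fun X Y => X = .par Y .nil, ?_, rfl⟩
  rintro _ P rfl a
  constructor
  · intro X hX
    rcases step_par_iff.1 hX with ⟨R, hR, rfl⟩ | ⟨R, hR, rfl⟩
    · exact ⟨R, hR, rfl⟩
    · exact (not_step_nil hR).elim
  · exact fun X hX => ⟨_, .parL _ hX, rfl⟩

theorem bisim_par_comm (P Q : Proc Act) : Bisim (.par P Q) (.par Q P) := by
  refine ⟨fun X Y => ∃ P Q, X = .par P Q ∧ Y = .par Q P, ?_, P, Q, rfl, rfl⟩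
  rintro _ _ ⟨P, Q, rfl, rfl⟩ a
  constructor
  · intro X hX
    rcases step_par_iff.1 hX with ⟨R, hR, rfl⟩ | ⟨R, hR, rfl⟩
    · exact ⟨_, .parR _ hR, _, _, rfl, rfl⟩
    · exact ⟨_, .parL _ hR, _, _, rfl, rfl⟩
  · intro X hX
    rcases step_par_iff.1 hX with ⟨R, hR, rfl⟩ | ⟨R, hR, rfl⟩
    · exact ⟨_, .parR _ hR, _, _, rfl, rfl⟩
    · exact ⟨_, .parL _ hR, _, _, rfl, rfl⟩

theorem bisim_par_assoc (P Q R : Proc Act) :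
    Bisim (.par (.par P Q) R) (.par P (.par Q R)) := by
  refine ⟨fun X Y => ∃ P Q R, X = .par (.par P Q) R ∧ Y = .par P (.par Q R), ?_,
    P, Q, R, rfl, rfl⟩
  rintro _ _ ⟨P, Q, R, rfl, rfl⟩ a
  constructor
  · intro X hX
    rcases step_par_iff.1 hX with ⟨S, hS, rfl⟩ | ⟨S, hS, rfl⟩
    · rcases step_par_iff.1 hS with ⟨U, hU, rfl⟩ | ⟨U, hU, rfl⟩
      · exact ⟨_, .parL _ hU, _, _, _, rfl, rfl⟩
      · exact ⟨_, .parR _ (.parL _ hU), _, _, _, rfl, rfl⟩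
    · exact ⟨_, .parR _ (.parR _ hS), _, _, _, rfl, rfl⟩
  · intro X hX
    rcases step_par_iff.1 hX with ⟨S, hS, rfl⟩ | ⟨S, hS, rfl⟩
    · exact ⟨_, .parL _ (.parL _ hS), _, _, _, rfl, rfl⟩
    · rcases step_par_iff.1 hS with ⟨U, hU, rfl⟩ | ⟨U, hU, rfl⟩
      · exact ⟨_, .parL _ (.parR _ hU), _, _, _, rfl, rfl⟩
      · exact ⟨_, .parR _ hU, _, _, _, rfl, rfl⟩

/-- Bisimilarity as a setoid. -/
def bisimSetoid (Act : Type u) : Setoid (Proc Act) :=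
  ⟨Bisim, Bisim.refl, Bisim.symm, Bisim.trans⟩

/-- Behaviours: processes up to bisimilarity. -/
def Beh (Act : Type u) : Type u := Quotient (bisimSetoid Act)

/-- The behaviour of a process. -/
def beh (P : Proc Act) : Beh Act := Quotient.mk (bisimSetoid Act) P

theorem beh_eq_iff {P Q : Proc Act} : beh P = beh Q ↔ Bisim P Q :=
  Quotient.eq (r := bisimSetoid Act)

theorem beh_surjective (x : Beh Act) : ∃ P, beh P = x := Quotient.exists_rep x

/-- Parallel composition of behaviours. -/
instance : Add (Beh Act) := ⟨Quotient.map₂ Proc.par fun _ _ h _ _ h' => Bisim.par h h'⟩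

/-- The neutral element is the class of the inert process. -/
instance : Zero (Beh Act) := ⟨beh .nil⟩

instance : AddCommMonoid (Beh Act) where
  add_assoc := by
    rintro ⟨P⟩ ⟨Q⟩ ⟨R⟩
    exact beh_eq_iff.2 (bisim_par_assoc P Q R)
  add_comm := by
    rintro ⟨P⟩ ⟨Q⟩
    exact beh_eq_iff.2 (bisim_par_comm P Q)
  zero_add := by
    rintro ⟨P⟩
    exact beh_eq_iff.2 ((bisim_par_comm _ _).trans (bisim_par_nil P))
  add_zero := by
    rintro ⟨P⟩
    exact beh_eq_iff.2 (bisim_par_nil P)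
  nsmul := nsmulRec

theorem beh_par (P Q : Proc Act) : beh (.par P Q) = beh P + beh Q := rfl

theorem beh_nil : beh (.nil : Proc Act) = 0 := rfl

/-- Transitions of behaviours. -/
def Trans (x : Beh Act) (a : Act) (y : Beh Act) : Prop :=
  ∃ P P', Step P a P' ∧ beh P = x ∧ beh P' = y

theorem trans_beh_iff {P : Proc Act} {a : Act} {y : Beh Act} :
    Trans (beh P) a y ↔ ∃ P', Step P a P' ∧ beh P' = y := by
  constructor
  · rintro ⟨Q, Q', hQ, hPQ, rfl⟩
    obtain ⟨P', hP, h⟩ := (isBisimulation_bisim _ _ (beh_eq_iff.1 hPQ) a).1 Q' hQ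
    exact ⟨P', hP, (beh_eq_iff.2 h).symm⟩
  · rintro ⟨P', hP, rfl⟩
    exact ⟨P, P', hP, rfl, rfl⟩

theorem Step.trans_beh {P P' : Proc Act} {a : Act} (h : Step P a P') :
    Trans (beh P) a (beh P') := ⟨P, P', h, rfl, rfl⟩

theorem trans_add_iff {x y z : Beh Act} {a : Act} : Trans (x + y) a z ↔
    (∃ x', Trans x a x' ∧ z = x' + y) ∨ ∃ y', Trans y a y' ∧ z = x + y' := by
  obtain ⟨P, rfl⟩ := beh_surjective x
  obtain ⟨Q, rfl⟩ := beh_surjective y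
  rw [← beh_par, trans_beh_iff]
  constructor
  · rintro ⟨R, hR, rfl⟩
    rcases step_par_iff.1 hR with ⟨S, hS, rfl⟩ | ⟨S, hS, rfl⟩
    · exact Or.inl ⟨_, hS.trans_beh, rfl⟩
    · exact Or.inr ⟨_, hS.trans_beh, rfl⟩
  · rintro (⟨x', hx, rfl⟩ | ⟨y', hy, rfl⟩)
    · obtain ⟨P', hP, rfl⟩ := trans_beh_iff.1 hx
      exact ⟨_, .parL _ hP, rfl⟩
    · obtain ⟨Q', hQ, rfl⟩ := trans_beh_iff.1 hy
      exact ⟨_, .parR _ hQ, rfl⟩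

theorem Trans.add_right {x x' : Beh Act} {a : Act} (h : Trans x a x') (y : Beh Act) :
    Trans (x + y) a (x' + y) := trans_add_iff.2 (Or.inl ⟨x', h, rfl⟩)

theorem Trans.add_left {y y' : Beh Act} {a : Act} (h : Trans y a y') (x : Beh Act) :
    Trans (x + y) a (x + y') := trans_add_iff.2 (Or.inr ⟨y', h, rfl⟩)

theorem not_trans_zero {a : Act} {y : Beh Act} : ¬ Trans 0 a y := by
  rw [← beh_nil, trans_beh_iff]
  rintro ⟨P, hP, -⟩
  exact not_step_nil hP

theorem trans_pre_iff {a b : Act} {F : FinProc Act} {y : Beh Act} :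
    Trans (beh (.pre a F)) b y ↔ b = a ∧ y = beh F.toProc := by
  rw [trans_beh_iff]
  constructor
  · rintro ⟨P, hP, rfl⟩
    cases hP
    exact ⟨rfl, rfl⟩
  · rintro ⟨rfl, rfl⟩
    exact ⟨_, .pre _ _, rfl⟩

theorem trans_bang_iff {a b : Act} {F : FinProc Act} {y : Beh Act} :
    Trans (beh (.bang a F)) b y ↔ b = a ∧ y = beh (.bang a F) + beh F.toProc := by
  rw [trans_beh_iff]
  constructor
  · rintro ⟨P, hP, rfl⟩
    cases hP
    exact ⟨rfl, rfl⟩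
  · rintro ⟨rfl, rfl⟩
    exact ⟨_, .bang _ _, rfl⟩

/-- Coinduction: related behaviours are equal if the relation is a bisimulation. -/
theorem Beh.eq_of_bisimulation (R : Beh Act → Beh Act → Prop)
    (h₁ : ∀ x y, R x y → ∀ a x', Trans x a x' → ∃ y', Trans y a y' ∧ R x' y')
    (h₂ : ∀ x y, R x y → ∀ a y', Trans y a y' → ∃ x', Trans x a x' ∧ R x' y')
    {x y : Beh Act} (hxy : R x y) : x = y := by
  obtain ⟨P, rfl⟩ := beh_surjective x
  obtain ⟨Q, rfl⟩ := beh_surjective y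
  refine beh_eq_iff.2 ⟨fun P Q => R (beh P) (beh Q), ?_, hxy⟩
  intro P Q hPQ a
  constructor
  · intro P' hP
    obtain ⟨y', hy, h⟩ := h₁ _ _ hPQ a _ hP.trans_beh
    obtain ⟨Q', hQ, rfl⟩ := trans_beh_iff.1 hy
    exact ⟨Q', hQ, h⟩
  · intro Q' hQ
    obtain ⟨x', hx, h⟩ := h₂ _ _ hPQ a _ hQ.trans_beh
    obtain ⟨P', hP, rfl⟩ := trans_beh_iff.1 hx
    exact ⟨P', hP, h⟩

theorem Beh.ext_of_trans {x y : Beh Act} (h : ∀ a z, Trans x a z ↔ Trans y a z) : x = y := by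
  refine Beh.eq_of_bisimulation (fun x y => x = y ∨ ∀ a z, Trans x a z ↔ Trans y a z)
    ?_ ?_ (Or.inr h)
  · rintro x y (rfl | h) a z hz
    · exact ⟨z, hz, Or.inl rfl⟩
    · exact ⟨z, (h a z).1 hz, Or.inl rfl⟩
  · rintro x y (rfl | h) a z hz
    · exact ⟨z, hz, Or.inl rfl⟩
    · exact ⟨z, (h a z).2 hz, Or.inl rfl⟩

/-! ### Behaviours of finite processes -/

/-- The behaviour of a finite process. -/
def fbeh (F : FinProc Act) : Beh Act := beh F.toProc

theorem fbeh_nil : fbeh (.nil : FinProc Act) = 0 := rfl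

theorem fbeh_par (F G : FinProc Act) : fbeh (.par F G) = fbeh F + fbeh G := rfl

theorem trans_fbeh_pre_iff {a b : Act} {F : FinProc Act} {y : Beh Act} :
    Trans (fbeh (.pre a F)) b y ↔ b = a ∧ y = fbeh F := trans_pre_iff

theorem fbeh_copies (F : FinProc Act) (n : ℕ) : fbeh (F.copies n) = n • fbeh F := by
  induction n with
  | zero => rw [zero_nsmul]; rfl
  | succ n ih => rw [FinProc.copies, fbeh_par, ih, succ_nsmul']

/-- All prefixed subterms `a.F` of a finite process satisfy `p a F`. -/
def FinProc.All (p : Act → FinProc Act → Prop) : FinProc Act → Prop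
  | .nil => True
  | .pre a F => p a F ∧ F.All p
  | .par F G => F.All p ∧ G.All p

/-- A transition of a finite process leads to a finite process with one prefix less, whose
prefixed subterms are among those of the given process. -/
theorem exists_all_of_trans_fbeh {p : Act → FinProc Act → Prop} {F : FinProc Act} {a : Act}
    {y : Beh Act} (hF : F.All p) (h : Trans (fbeh F) a y) :
    ∃ F', y = fbeh F' ∧ F.size = F'.size + 1 ∧ F'.All p := by
  induction F generalizing y with
  | nil => exact (not_trans_zero h).elim
  | pre b F =>
    obtain ⟨-, rfl⟩ := trans_fbeh_pre_iff.1 h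
    exact ⟨F, rfl, rfl, hF.2⟩
  | par F G ihF ihG =>
    rw [fbeh_par] at h
    rcases trans_add_iff.1 h with ⟨x, hx, rfl⟩ | ⟨x, hx, rfl⟩
    · obtain ⟨F', rfl, h', hF'⟩ := ihF hF.1 hx
      exact ⟨.par F' G, rfl, by simp only [FinProc.size]; omega, hF', hF.2⟩
    · obtain ⟨G', rfl, h', hG'⟩ := ihG hF.2 hx
      exact ⟨.par F G', rfl, by simp only [FinProc.size]; omega, hF.1, hG'⟩

theorem FinProc.all_true (F : FinProc Act) : F.All fun _ _ => True := by
  induction F with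
  | nil => trivial
  | pre a F ih => exact ⟨trivial, ih⟩
  | par F G ihF ihG => exact ⟨ihF, ihG⟩

theorem exists_of_trans_fbeh {F : FinProc Act} {a : Act} {y : Beh Act}
    (h : Trans (fbeh F) a y) : ∃ F', y = fbeh F' ∧ F.size = F'.size + 1 := by
  obtain ⟨F', h1, h2, -⟩ := exists_all_of_trans_fbeh F.all_true h
  exact ⟨F', h1, h2⟩

theorem fbeh_eq_zero_of_size {F : FinProc Act} (h : F.size = 0) : fbeh F = 0 := by
  induction F with
  | nil => rfl
  | pre a F => simp [FinProc.size] at h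
  | par F G ihF ihG =>
    simp only [FinProc.size] at h
    rw [fbeh_par, ihF (by omega), ihG (by omega), add_zero]

theorem exists_trans_of_size_ne_zero {F : FinProc Act} (h : F.size ≠ 0) :
    ∃ a y, Trans (fbeh F) a y := by
  induction F with
  | nil => exact (h rfl).elim
  | pre a F => exact ⟨a, _, trans_fbeh_pre_iff.2 ⟨rfl, rfl⟩⟩
  | par F G ihF ihG =>
    rw [fbeh_par]
    by_cases hF : F.size = 0
    · obtain ⟨a, y, hy⟩ := ihG (by simp only [FinProc.size] at h; omega)
      exact ⟨a, fbeh F + y, hy.add_left _⟩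
    · obtain ⟨a, y, hy⟩ := ihF hF
      exact ⟨a, y + fbeh G, hy.add_right _⟩

/-- Each transition consumes one prefix and only size zero is inert, so the size is the length of
any maximal run, a bisimulation invariant. -/
theorem size_eq_of_fbeh_eq {F G : FinProc Act} (h : fbeh F = fbeh G) : F.size = G.size := by
  induction hn : F.size generalizing F G with
  | zero =>
    by_contra hG
    obtain ⟨a, y, hy⟩ := exists_trans_of_size_ne_zero (F := G) (by omega)
    rw [← h, fbeh_eq_zero_of_size hn] at hy
    exact not_trans_zero hy
  | succ n ih =>
    obtain ⟨a, y, hy⟩ := exists_trans_of_size_ne_zero (F := F) (by omega)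
    obtain ⟨F', rfl, hF⟩ := exists_of_trans_fbeh hy
    rw [h] at hy
    obtain ⟨G', hFG, hG⟩ := exists_of_trans_fbeh hy
    rw [hG, ← ih hFG (by omega)]

/-- The submonoid of finite behaviours. -/
def finBeh (Act : Type u) : AddSubmonoid (Beh Act) where
  carrier := Set.range fbeh
  zero_mem' := ⟨.nil, rfl⟩
  add_mem' := by
    rintro _ _ ⟨F, rfl⟩ ⟨G, rfl⟩
    exact ⟨.par F G, rfl⟩

/-- The behaviour of a finite process, as a finite behaviour. -/
def fb (F : FinProc Act) : finBeh Act := ⟨fbeh F, F, rfl⟩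

theorem fb_surjective (x : finBeh Act) : ∃ F, fb F = x := by
  obtain ⟨_, F, rfl⟩ := x
  exact ⟨F, rfl⟩

theorem fb_eq_iff {F G : FinProc Act} : fb F = fb G ↔ fbeh F = fbeh G := Subtype.ext_iff

theorem fb_par (F G : FinProc Act) : fb (.par F G) = fb F + fb G := rfl

theorem fb_nil : fb (.nil : FinProc Act) = 0 := rfl

/-- Transitions of finite behaviours. -/
def FTrans (x : finBeh Act) (a : Act) (y : finBeh Act) : Prop := Trans (x : Beh Act) a y

/-- The size of a finite behaviour. -/
noncomputable def fsize (x : finBeh Act) : ℕ := (fb_surjective x).choose.size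

theorem fsize_fb (F : FinProc Act) : fsize (fb F) = F.size :=
  size_eq_of_fbeh_eq (fb_eq_iff.1 (fb_surjective (fb F)).choose_spec)

theorem exists_fb_of_trans {x : finBeh Act} {a : Act} {y : Beh Act}
    (h : Trans (x : Beh Act) a y) : ∃ y' : finBeh Act, FTrans x a y' ∧ y = y' := by
  obtain ⟨F, rfl⟩ := fb_surjective x
  obtain ⟨F', rfl, -⟩ := exists_of_trans_fbeh h
  exact ⟨fb F', h, rfl⟩

theorem isInterleaving_finBeh :
    IsInterleaving (FTrans (Act := Act)) (fsize (Act := Act)) where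
  sz_add x y := by
    obtain ⟨F, rfl⟩ := fb_surjective x
    obtain ⟨G, rfl⟩ := fb_surjective y
    rw [← fb_par, fsize_fb, fsize_fb, fsize_fb]
    rfl
  sz_step {x a y} h := by
    obtain ⟨F, rfl⟩ := fb_surjective x
    obtain ⟨G, hG, hF⟩ := exists_of_trans_fbeh h
    obtain rfl : y = fb G := Subtype.ext hG
    rw [fsize_fb, fsize_fb, hF]
  exists_step {x} h := by
    obtain ⟨F, rfl⟩ := fb_surjective x
    obtain ⟨a, y, hy⟩ := exists_trans_of_size_ne_zero (F := F) fun h0 =>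
      h (Subtype.ext (fbeh_eq_zero_of_size h0))
    obtain ⟨y', hy', -⟩ := exists_fb_of_trans (x := fb F) hy
    exact ⟨a, y', hy'⟩
  step_add {x y a z} := by
    constructor
    · intro h
      rcases trans_add_iff.1 h with ⟨x', hx, hz⟩ | ⟨y', hy, hz⟩
      · obtain ⟨x'', hx', rfl⟩ := exists_fb_of_trans hx
        exact Or.inl ⟨x'', hx', Subtype.ext hz⟩
      · obtain ⟨y'', hy', rfl⟩ := exists_fb_of_trans hy
        exact Or.inr ⟨y'', hy', Subtype.ext hz⟩
    · rintro (⟨x', hx, rfl⟩ | ⟨y', hy, rfl⟩)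
      · exact Trans.add_right hx _
      · exact Trans.add_left hy _

/-! ### Processes up to the distribution law -/

/-- The congruence of the distribution law as a setoid. -/
def eqDSetoid (Act : Type u) : Setoid (Proc Act) :=
  ⟨EqD, EqD.refl, EqD.symm, EqD.trans⟩

/-- Processes up to the distribution law. -/
def DProc (Act : Type u) : Type u := Quotient (eqDSetoid Act)

/-- The class of a process up to the distribution law. -/
def dcl (P : Proc Act) : DProc Act := Quotient.mk (eqDSetoid Act) P

theorem dcl_eq_iff {P Q : Proc Act} : dcl P = dcl Q ↔ EqD P Q :=
  Quotient.eq (r := eqDSetoid Act)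

/-- Parallel composition up to the distribution law. -/
instance : Add (DProc Act) := ⟨Quotient.map₂ Proc.par fun _ _ h _ _ h' => EqD.par h h'⟩

/-- The neutral element is the class of the inert process. -/
instance : Zero (DProc Act) := ⟨dcl .nil⟩

instance : AddCommMonoid (DProc Act) where
  add_assoc := by
    rintro ⟨P⟩ ⟨Q⟩ ⟨R⟩
    exact dcl_eq_iff.2 (.par_assoc P Q R)
  add_comm := by
    rintro ⟨P⟩ ⟨Q⟩
    exact dcl_eq_iff.2 (.par_comm P Q)
  zero_add := by
    rintro ⟨P⟩
    exact dcl_eq_iff.2 (.trans (.par_comm _ _) (.par_nil P))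
  add_zero := by
    rintro ⟨P⟩
    exact dcl_eq_iff.2 (.par_nil P)
  nsmul := nsmulRec

theorem dcl_par (P Q : Proc Act) : dcl (.par P Q) = dcl P + dcl Q := rfl

theorem dcl_copies (F : FinProc Act) (n : ℕ) :
    dcl (F.copies n).toProc = n • dcl F.toProc := by
  induction n with
  | zero => rw [zero_nsmul]; rfl
  | succ n ih => rw [FinProc.copies, FinProc.toProc, dcl_par, ih, succ_nsmul']

/-! ### Completeness of the distribution law for finite processes -/

theorem exists_pre_of_indecomposable {F : FinProc Act} (h : Indecomposable (fb F)) :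
    ∃ a H, fb F = fb (.pre a H) := by
  induction F with
  | nil => exact (h.1 rfl).elim
  | pre a F => exact ⟨a, F, rfl⟩
  | par F G ihF ihG =>
    rw [fb_par] at h ⊢
    rcases h.2 _ _ rfl with h0 | h0
    · rw [h0, zero_add] at h ⊢
      exact ihG h
    · rw [h0, add_zero] at h ⊢
      exact ihF h

theorem fb_pre_ne_zero (a : Act) (F : FinProc Act) : fb (.pre a F) ≠ 0 := by
  rw [← fb_nil, Ne, fb_eq_iff]
  exact fun h => by simpa [FinProc.size] using size_eq_of_fbeh_eq h

/-- Every finite process is, up to the distribution law and up to bisimilarity, a parallel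
composition of prefixed processes with indecomposable behaviour, provided that the distribution
law is complete for smaller processes. -/
theorem exists_indecomposable_decomposition {n : ℕ}
    (ih : ∀ F G : FinProc Act, F.size < n → fbeh F = fbeh G → EqD F.toProc G.toProc)
    (F : FinProc Act) (hF : F.size ≤ n) : ∃ s : Multiset (Act × FinProc Act),
      dcl F.toProc = (s.map fun p => dcl (.pre p.1 p.2)).sum ∧
      fb F = (s.map fun p => fb (.pre p.1 p.2)).sum ∧
      ∀ p ∈ s, Indecomposable (fb (.pre p.1 p.2)) := by
  induction F with
  | nil => exact ⟨0, rfl, rfl, by simp⟩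
  | par F G ihF ihG =>
    simp only [FinProc.size] at hF
    obtain ⟨s, h1, h2, h3⟩ := ihF (by omega)
    obtain ⟨t, h4, h5, h6⟩ := ihG (by omega)
    refine ⟨s + t, ?_, ?_, fun p hp => (Multiset.mem_add.1 hp).elim (h3 p) (h6 p)⟩
    · rw [FinProc.toProc, dcl_par, h1, h4, Multiset.map_add, Multiset.sum_add]
    · rw [fb_par, h2, h5, Multiset.map_add, Multiset.sum_add]
  | pre a F =>
    obtain ⟨p, k, hp, hk⟩ := isInterleaving_finBeh.exists_nsmul_of_step_unique
      (fb_pre_ne_zero a F) (by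
        intro b y c z hy hz
        exact Subtype.ext ((trans_fbeh_pre_iff.1 hy).2.trans (trans_fbeh_pre_iff.1 hz).2.symm))
    obtain ⟨G, rfl⟩ := fb_surjective p
    obtain ⟨b, H, hbH⟩ := exists_pre_of_indecomposable hp
    rw [hbH] at hp hk
    -- Firing one of the `k + 1` copies of `b.H` must give the unique derivative of `a.F`. Hence `b
    -- = a`, and `F` is bisimilar to the body on the left of the distribution law.
    have hstep : Trans (fbeh (.pre a F)) b (fbeh H + k • fbeh (.pre b H)) := by
      have : fbeh (.pre a F) = fbeh (.pre b H) + k • fbeh (.pre b H) := by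
        rw [← succ_nsmul']
        exact congrArg Subtype.val hk
      rw [this]
      exact (trans_fbeh_pre_iff.2 ⟨rfl, rfl⟩).add_right _
    obtain ⟨rfl, hF'⟩ := trans_fbeh_pre_iff.1 hstep
    have hD : EqD F.toProc (FinProc.par H ((FinProc.pre b H).copies k)).toProc :=
      ih _ _ hF (by rw [fbeh_par, fbeh_copies, hF'])
    refine ⟨Multiset.replicate (k + 1) (b, H), ?_, ?_, fun p hp' => ?_⟩
    · rw [Multiset.map_replicate, Multiset.sum_replicate]
      refine (dcl_eq_iff.2 ((EqD.pre b hD).trans (.distrib b H k))).trans ?_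
      exact dcl_copies _ _
    · rw [Multiset.map_replicate, Multiset.sum_replicate, hk]
    · rw [Multiset.eq_of_mem_replicate hp']
      exact hp

theorem sum_map_eq_of_rel {α β : Type*} [AddCommMonoid β] {r : α → α → Prop} {f : α → β}
    {s t : Multiset α} (h : Multiset.Rel r s t) (hf : ∀ x y, x ∈ s → r x y → f x = f y) :
    (s.map f).sum = (t.map f).sum := by
  induction h with
  | zero => rfl
  | @cons x y s t hxy hst ih =>
    rw [Multiset.map_cons, Multiset.map_cons, Multiset.sum_cons, Multiset.sum_cons,
      hf x y (Multiset.mem_cons_self x s) hxy,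
      ih fun u v hu => hf u v (Multiset.mem_cons_of_mem hu)]

/-- Passes from equal multisets of behaviours (`g`) to equal sums of classes for the distribution
law (`f`), one matched pair of components at a time. -/
theorem sum_map_eq_of_map_eq {α β γ : Type*} [AddCommMonoid β] {f : α → β} {g : α → γ}
    {s t : Multiset α} (h : s.map g = t.map g) (hf : ∀ x y, x ∈ s → g x = g y → f x = f y) :
    (s.map f).sum = (t.map f).sum := by
  rw [← Multiset.rel_eq, Multiset.rel_map] at h
  exact sum_map_eq_of_rel h hf

/-- The distribution law is complete for bisimilarity of finite processes. -/
theorem eqD_of_fbeh_eq {F G : FinProc Act} (h : fbeh F = fbeh G) :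
    EqD F.toProc G.toProc := by
  induction hn : F.size using Nat.strong_induction_on generalizing F G with
  | _ n ih =>
    have ih' : ∀ F G : FinProc Act, F.size < n → fbeh F = fbeh G → EqD F.toProc G.toProc :=
      fun F G hF hFG => ih _ hF hFG rfl
    obtain ⟨s, h1, h2, h3⟩ := exists_indecomposable_decomposition ih' F hn.le
    obtain ⟨t, h4, h5, h6⟩ := exists_indecomposable_decomposition ih' G
      (by rw [← size_eq_of_fbeh_eq h, hn])
    have hst := isInterleaving_finBeh.unique_decomposition
      (s := s.map fun p => fb (.pre p.1 p.2)) (t := t.map fun p => fb (.pre p.1 p.2))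
      (by simpa only [Multiset.forall_mem_map_iff] using h3)
      (by simpa only [Multiset.forall_mem_map_iff] using h6)
      (by rw [← h2, ← h5, fb_eq_iff, h])
    refine dcl_eq_iff.1 (h1.trans (Eq.trans (sum_map_eq_of_map_eq hst ?_) h4.symm))
    rintro ⟨a, H⟩ ⟨b, K⟩ hp hpq
    have hHK : Trans (fbeh (.pre b K)) a (fbeh H) := by
      rw [← fb_eq_iff.1 hpq]
      exact trans_fbeh_pre_iff.2 ⟨rfl, rfl⟩
    obtain ⟨rfl, hHK'⟩ := trans_fbeh_pre_iff.1 hHK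
    refine dcl_eq_iff.2 (.pre _ (ih' H K ?_ hHK'))
    -- The prefix `a.H` is a factor of `F`, so its body `H` is strictly smaller than `F`.
    have hle := isInterleaving_finBeh.sz_le_of_mem
      (Multiset.mem_map_of_mem (fun p => fb (.pre p.1 p.2)) hp)
    rw [← h2, fsize_fb, fsize_fb, hn] at hle
    exact hle

/-! ### Replicated processes -/

/-- The behaviour of the parallel composition of the replicated prefixes `!a.F`, for `(a, F)` in
a multiset. -/
def bangs (s : Multiset (Act × FinProc Act)) : Beh Act :=
  (s.map fun p => beh (.bang p.1 p.2)).sum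

theorem bangs_cons (p : Act × FinProc Act) (s : Multiset (Act × FinProc Act)) :
    bangs (p ::ₘ s) = beh (.bang p.1 p.2) + bangs s := by
  rw [bangs, Multiset.map_cons, Multiset.sum_cons, bangs]

theorem trans_bangs_iff {s : Multiset (Act × FinProc Act)} {a : Act} {y : Beh Act} :
    Trans (bangs s) a y ↔ ∃ F, (a, F) ∈ s ∧ y = bangs s + fbeh F := by
  induction s using Multiset.induction_on generalizing y with
  | empty =>
    refine ⟨fun h => (not_trans_zero h).elim, ?_⟩
    rintro ⟨F, hF, -⟩
    exact (Multiset.notMem_zero _ hF).elim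
  | cons p s ih =>
    obtain ⟨b, G⟩ := p
    rw [bangs_cons, trans_add_iff]
    constructor
    · rintro (⟨x, hx, rfl⟩ | ⟨x, hx, rfl⟩)
      · obtain ⟨rfl, rfl⟩ := trans_bang_iff.1 hx
        exact ⟨G, Multiset.mem_cons_self _ _, add_right_comm _ _ _⟩
      · obtain ⟨F, hF, rfl⟩ := ih.1 hx
        exact ⟨F, Multiset.mem_cons_of_mem hF, (add_assoc _ _ _).symm⟩
    · rintro ⟨F, hF, rfl⟩
      rcases Multiset.mem_cons.1 hF with h | h
      · obtain ⟨rfl, rfl⟩ := Prod.mk.inj h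
        exact Or.inl ⟨_, trans_bang_iff.2 ⟨rfl, rfl⟩, add_right_comm _ _ _⟩
      · exact Or.inr ⟨_, ih.2 ⟨F, h, rfl⟩, add_assoc _ _ _⟩

/-- The derivatives of `bangs s + g` have the same replicated part. -/
theorem exists_of_trans_bangs_add {s : Multiset (Act × FinProc Act)} {a : Act} {g y : Beh Act}
    (h : Trans (bangs s + g) a y) : ∃ g', y = bangs s + g' := by
  rcases trans_add_iff.1 h with ⟨x, hx, rfl⟩ | ⟨x, hx, rfl⟩
  · obtain ⟨F, -, rfl⟩ := trans_bangs_iff.1 hx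
    exact ⟨fbeh F + g, add_assoc _ _ _⟩
  · exact ⟨x, rfl⟩

/-- Antisymmetry of the order `y ≤ x ↔ ∃ d, x = y + d`, for behaviours whose replicated parts
absorb both differences. -/
theorem eq_of_eq_add_of_eq_add {s t : Multiset (Act × FinProc Act)} {d e x y g g' : Beh Act}
    (hs : bangs s + (d + e) = bangs s) (ht : bangs t + (d + e) = bangs t)
    (hx : x = bangs s + g) (hy : y = bangs t + g') (hxy : x = y + d) (hyx : y = x + e) :
    x = y := by
  have absorb : ∀ {u : Multiset (Act × FinProc Act)} {d e : Beh Act},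
      bangs u + (d + e) = bangs u → ∀ g, bangs u + g + d + e = bangs u + g := by
    intro u d e hu g
    conv_rhs => rw [← hu]
    ac_rfl
  have half : ∀ (s t : Multiset (Act × FinProc Act)) (d e : Beh Act),
      bangs s + (d + e) = bangs s → bangs t + (d + e) = bangs t → ∀ x y,
      (∃ g, x = bangs s + g) → (∃ g, y = bangs t + g) → x = y + d → y = x + e →
      ∀ a x', Trans x a x' → ∃ y', Trans y a y' ∧
        (∃ g, x' = bangs s + g) ∧ (∃ g, y' = bangs t + g) ∧ x' = y' + d ∧ y' = x' + e := by
    rintro s t d e hs ht x y ⟨g, hx⟩ ⟨g', hy⟩ hxy hyx a x' hT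
    have hx' : ∃ g, x' = bangs s + g := exists_of_trans_bangs_add (hx ▸ hT)
    rw [hxy] at hT
    rcases trans_add_iff.1 hT with ⟨y', hy', rfl⟩ | ⟨d', hd', rfl⟩
    · obtain ⟨g'', rfl⟩ := exists_of_trans_bangs_add (hy ▸ hy')
      exact ⟨_, hy', hx', ⟨g'', rfl⟩, rfl, (absorb ht g'').symm⟩
    -- A move of `d` inside `x = y + d` is answered by `y` itself, seen as `y + d + e`. The other
    -- case, a move of `y`, needs the derivative to absorb `d + e` again; it does, because it still
    -- contains `bangs t`.
    · have h1 : y = y + d + e := by rw [← hxy, ← hyx]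
      have h2 : Trans y a (y + d' + e) := by
        have := (hd'.add_left y).add_right e
        rwa [← h1] at this
      refine ⟨_, h2, hx', exists_of_trans_bangs_add (g := g') (by rwa [← hy]), ?_, rfl⟩
      have h3 : y + d' + e + d = y + d + e + d' := by ac_rfl
      rw [h3, ← h1]
  refine Beh.eq_of_bisimulation (fun x y => (∃ g, x = bangs s + g) ∧ (∃ g, y = bangs t + g) ∧
    x = y + d ∧ y = x + e) ?_ ?_ ⟨⟨g, hx⟩, ⟨g', hy⟩, hxy, hyx⟩
  · rintro x y ⟨h1, h2, h3, h4⟩ a x' hT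
    exact half s t d e hs ht x y h1 h2 h3 h4 a x' hT
  · rintro x y ⟨h1, h2, h3, h4⟩ a y' hT
    obtain ⟨x', hx', h5, h6, h7, h8⟩ := half t s e d (by rwa [add_comm e d])
      (by rwa [add_comm e d]) y x h2 h1 h4 h3 a y' hT
    exact ⟨x', hx', h6, h5, h8, h7⟩

/-- Each of `bangs s` and `bangs s + c` is obtained from the other by adding a behaviour, so
antisymmetry applies. -/
theorem absorb_of_absorb_add {s : Multiset (Act × FinProc Act)} {c d : Beh Act}
    (h : bangs s + (c + d) = bangs s) : bangs s + c = bangs s := by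
  refine (eq_of_eq_add_of_eq_add (s := s) (t := s) (d := d) (e := c) (g := 0) (g' := c)
    ?_ ?_ (add_zero _).symm rfl ?_ rfl).symm
  · rwa [add_comm d c]
  · rwa [add_comm d c]
  · rw [add_assoc, h]

/-- Prefixing preserves equality relative to a replicated process. -/
theorem bangs_add_pre_congr {s : Multiset (Act × FinProc Act)} {F G : FinProc Act}
    (h : bangs s + fbeh F = bangs s + fbeh G) (a : Act) :
    bangs s + fbeh (.pre a F) = bangs s + fbeh (.pre a G) := by
  have half : ∀ F G : FinProc Act, bangs s + fbeh F = bangs s + fbeh G → ∀ z b x',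
      Trans (bangs s + fbeh (.pre a F) + z) b x' → ∃ y',
      Trans (bangs s + fbeh (.pre a G) + z) b y' ∧ (x' = y' ∨ ∃ z,
        x' = bangs s + fbeh (.pre a F) + z ∧ y' = bangs s + fbeh (.pre a G) + z) := by
    intro F G h z b x' hT
    rcases trans_add_iff.1 hT with ⟨x, hx, rfl⟩ | ⟨z', hz, rfl⟩
    · rcases trans_add_iff.1 hx with ⟨w, hw, rfl⟩ | ⟨w, hw, rfl⟩
      · refine ⟨_, (hw.add_right (fbeh (.pre a G))).add_right z, Or.inr ?_⟩
        obtain ⟨H, -, rfl⟩ := trans_bangs_iff.1 hw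
        exact ⟨fbeh H + z, by ac_rfl, by ac_rfl⟩
      · obtain ⟨rfl, rfl⟩ := trans_fbeh_pre_iff.1 hw
        refine ⟨bangs s + fbeh G + z, ?_, Or.inl (by rw [h])⟩
        exact ((trans_fbeh_pre_iff.2 ⟨rfl, rfl⟩).add_left _).add_right _
    · exact ⟨_, hz.add_left _, Or.inr ⟨z', rfl, rfl⟩⟩
  -- The context `z` collects the copies spawned by `bangs s`. Once the prefix fires, the two sides
  -- become equal by `h`, since `bangs s` is still present.
  refine Beh.eq_of_bisimulation (fun x y => x = y ∨ ∃ z,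
    x = bangs s + fbeh (.pre a F) + z ∧ y = bangs s + fbeh (.pre a G) + z) ?_ ?_
    (Or.inr ⟨0, (add_zero _).symm, (add_zero _).symm⟩)
  · rintro x y (rfl | ⟨z, rfl, rfl⟩) b x' hT
    · exact ⟨x', hT, Or.inl rfl⟩
    · exact half F G h z b x' hT
  · rintro x y (rfl | ⟨z, rfl, rfl⟩) b y' hT
    · exact ⟨y', hT, Or.inl rfl⟩
    · obtain ⟨x', hx', rfl | ⟨z, h1, h2⟩⟩ := half G F h.symm z b y' hT
      · exact ⟨_, hx', Or.inl rfl⟩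
      · exact ⟨x', hx', Or.inr ⟨z, h2, h1⟩⟩

/-- The body of a replicated prefix can be replaced by an equivalent one, relative to the whole
replicated process. -/
theorem bangs_cons_congr {s : Multiset (Act × FinProc Act)} {a : Act} {F G : FinProc Act}
    (h : bangs ((a, F) ::ₘ s) + fbeh F = bangs ((a, F) ::ₘ s) + fbeh G) :
    bangs ((a, F) ::ₘ s) = bangs ((a, G) ::ₘ s) := by
  refine Beh.eq_of_bisimulation (fun x y => ∃ z,
    x = bangs ((a, F) ::ₘ s) + z ∧ y = bangs ((a, G) ::ₘ s) + z) ?_ ?_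
    ⟨0, (add_zero _).symm, (add_zero _).symm⟩
  · rintro _ _ ⟨z, rfl, rfl⟩ b x' hT
    rcases trans_add_iff.1 hT with ⟨x, hx, rfl⟩ | ⟨z', hz, rfl⟩
    · obtain ⟨H, hH, rfl⟩ := trans_bangs_iff.1 hx
      rcases Multiset.mem_cons.1 hH with h' | h'
      · obtain ⟨rfl, rfl⟩ := Prod.mk.inj h'
        refine ⟨_, (trans_bangs_iff.2 ⟨G, Multiset.mem_cons_self _ _, rfl⟩).add_right z,
          fbeh G + z, ?_, add_assoc _ _ _⟩
        rw [h, add_assoc]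
      · exact ⟨_, (trans_bangs_iff.2 ⟨H, Multiset.mem_cons_of_mem h', rfl⟩).add_right z,
          fbeh H + z, add_assoc _ _ _, add_assoc _ _ _⟩
    · exact ⟨_, hz.add_left _, z', rfl, rfl⟩
  · rintro _ _ ⟨z, rfl, rfl⟩ b x' hT
    rcases trans_add_iff.1 hT with ⟨x, hx, rfl⟩ | ⟨z', hz, rfl⟩
    · obtain ⟨H, hH, rfl⟩ := trans_bangs_iff.1 hx
      rcases Multiset.mem_cons.1 hH with h' | h'
      · obtain ⟨rfl, rfl⟩ := Prod.mk.inj h'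
        refine ⟨_, (trans_bangs_iff.2 ⟨F, Multiset.mem_cons_self _ _, rfl⟩).add_right z,
          fbeh H + z, ?_, add_assoc _ _ _⟩
        rw [h, add_assoc]
      · exact ⟨_, (trans_bangs_iff.2 ⟨H, Multiset.mem_cons_of_mem h', rfl⟩).add_right z,
          fbeh H + z, add_assoc _ _ _, add_assoc _ _ _⟩
    · exact ⟨_, hz.add_left _, z', rfl, rfl⟩

theorem bangs_cons_of_mem {s : Multiset (Act × FinProc Act)} {a : Act} {F G : FinProc Act}
    (hG : (a, G) ∈ s) (h : fbeh F = fbeh G) : bangs ((a, F) ::ₘ s) = bangs s := by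
  refine Beh.eq_of_bisimulation (fun x y => ∃ z,
    x = bangs ((a, F) ::ₘ s) + z ∧ y = bangs s + z) ?_ ?_
    ⟨0, (add_zero _).symm, (add_zero _).symm⟩
  · rintro _ _ ⟨z, rfl, rfl⟩ b x' hT
    rcases trans_add_iff.1 hT with ⟨x, hx, rfl⟩ | ⟨z', hz, rfl⟩
    · obtain ⟨H, hH, rfl⟩ := trans_bangs_iff.1 hx
      obtain ⟨K, hK, hHK⟩ : ∃ K, (b, K) ∈ s ∧ fbeh H = fbeh K := by
        rcases Multiset.mem_cons.1 hH with h' | h'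
        · obtain ⟨rfl, rfl⟩ := Prod.mk.inj h'
          exact ⟨G, hG, h⟩
        · exact ⟨H, h', rfl⟩
      exact ⟨_, (trans_bangs_iff.2 ⟨K, hK, rfl⟩).add_right z, fbeh K + z,
        by rw [hHK, add_assoc], add_assoc _ _ _⟩
    · exact ⟨_, hz.add_left _, z', rfl, rfl⟩
  · rintro _ _ ⟨z, rfl, rfl⟩ b x' hT
    rcases trans_add_iff.1 hT with ⟨x, hx, rfl⟩ | ⟨z', hz, rfl⟩
    · obtain ⟨H, hH, rfl⟩ := trans_bangs_iff.1 hx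
      exact ⟨_, (trans_bangs_iff.2 ⟨H, Multiset.mem_cons_of_mem hH, rfl⟩).add_right z,
        fbeh H + z, add_assoc _ _ _, add_assoc _ _ _⟩
    · exact ⟨_, hz.add_left _, z', rfl, rfl⟩

/-! ### Reduced finite processes -/

/-- A finite process is reduced relative to a replicated process if none of its prefixed subterms
is absorbed by the replicated process. -/
def Reduced (s : Multiset (Act × FinProc Act)) : FinProc Act → Prop :=
  FinProc.All fun a F => bangs s + fbeh (.pre a F) ≠ bangs s

/-- If a parallel composition is absorbed then so is each component, and a reduced process has no
absorbed prefix. -/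
theorem Reduced.size_eq_zero {s : Multiset (Act × FinProc Act)} {F : FinProc Act}
    (hF : Reduced s F) (h : bangs s + fbeh F = bangs s) : F.size = 0 := by
  induction F with
  | nil => rfl
  | pre a F => exact (hF.1 h).elim
  | par F G ihF ihG =>
    rw [fbeh_par] at h
    have h1 := ihF hF.1 (absorb_of_absorb_add h)
    have h2 := ihG hF.2 (absorb_of_absorb_add (by rwa [add_comm (fbeh G)]))
    simp only [FinProc.size]
    omega

/-- A process which is not reduced can be replaced by a smaller one. -/
theorem exists_smaller_of_not_reduced {s : Multiset (Act × FinProc Act)} {F : FinProc Act}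
    (hF : ¬ Reduced s F) : ∃ G : FinProc Act, bangs s + fbeh G = bangs s + fbeh F ∧
      G.size < F.size := by
  induction F with
  | nil => exact (hF trivial).elim
  | pre a F ih =>
    by_cases h : bangs s + fbeh (.pre a F) = bangs s
    · exact ⟨.nil, by rw [h, fbeh_nil, add_zero], Nat.succ_pos _⟩
    · obtain ⟨G, h1, h2⟩ := ih fun hF' => hF ⟨h, hF'⟩
      exact ⟨.pre a G, bangs_add_pre_congr h1 a, Nat.succ_lt_succ h2⟩
  | par F G ihF ihG =>
    by_cases h : Reduced s F
    · obtain ⟨G', h1, h2⟩ := ihG fun hG => hF ⟨h, hG⟩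
      refine ⟨.par F G', ?_, Nat.add_lt_add_left h2 _⟩
      rw [fbeh_par, fbeh_par, add_left_comm, h1, add_left_comm]
    · obtain ⟨F', h1, h2⟩ := ihF h
      refine ⟨.par F' G, ?_, Nat.add_lt_add_right h2 _⟩
      rw [fbeh_par, fbeh_par, ← add_assoc, h1, add_assoc]

/-- Reduced finite processes which are equivalent relative to a replicated process with reduced
bodies are bisimilar. -/
theorem fbeh_eq_of_reduced {s : Multiset (Act × FinProc Act)}
    (hs : ∀ p ∈ s, Reduced s p.2) {F G : FinProc Act} (hF : Reduced s F) (hG : Reduced s G)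
    (h : bangs s + fbeh F = bangs s + fbeh G) : fbeh F = fbeh G := by
  induction hn : F.size using Nat.strong_induction_on generalizing F G with
  | _ n ih =>
    rcases lt_or_ge G.size n with hlt | hge
    -- By symmetry the induction may be run on the smaller process; from here on, `F` is at most as
    -- large as `G`.
    · exact (ih _ hlt hG hF h.symm rfl).symm
    have fwd : ∀ a z, Trans (fbeh F) a z →
        ∃ F' G' : FinProc Act, Trans (fbeh G) a (fbeh G') ∧ F.size = F'.size + 1 ∧
          G.size = G'.size + 1 ∧ z = fbeh F' ∧ fbeh F' = fbeh G' := by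
      intro a z hz
      obtain ⟨F', rfl, hsz, hF'⟩ := exists_all_of_trans_fbeh hF hz
      have hT := hz.add_left (bangs s)
      rw [h] at hT
      rcases trans_add_iff.1 hT with ⟨x, hx, heq⟩ | ⟨x, hx, heq⟩
      · obtain ⟨H, hH, rfl⟩ := trans_bangs_iff.1 hx
        -- If the move were answered by spawning a body `H`, induction would make `F'` bisimilar to
        -- `H | G`, which is impossible because `F'` is smaller than `F`, hence than `G`.
        have hHG : fbeh F' = fbeh (.par H G) :=
          ih F'.size (by omega) hF' ⟨hs _ hH, hG⟩ (by rw [heq, fbeh_par, add_assoc]) rfl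
        have := size_eq_of_fbeh_eq hHG
        simp only [FinProc.size] at this
        omega
      · obtain ⟨G', rfl, hsz', hG'⟩ := exists_all_of_trans_fbeh hG hx
        exact ⟨F', G', hx, hsz, hsz', rfl, ih F'.size (by omega) hF' hG' heq rfl⟩
    by_cases hn0 : n = 0
    · have hF0 := fbeh_eq_zero_of_size (hn.trans hn0)
      rw [hF0, add_zero] at h
      rw [hF0, fbeh_eq_zero_of_size (hG.size_eq_zero h.symm)]
    -- One move of `F` is answered by `G` with bisimilar derivatives, so the sizes agree. The
    -- derivatives of `G` then also fall under the induction hypothesis.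
    have hsize : G.size = n := by
      obtain ⟨a, z, hz⟩ := exists_trans_of_size_ne_zero (F := F) (by omega)
      obtain ⟨F', G', -, h1, h2, -, h3⟩ := fwd a z hz
      have := size_eq_of_fbeh_eq h3
      omega
    refine Beh.ext_of_trans fun a z => ⟨fun hz => ?_, fun hz => ?_⟩
    · obtain ⟨F', G', hT, -, -, rfl, h3⟩ := fwd a z hz
      rwa [h3]
    · obtain ⟨G', rfl, hsz, hG'⟩ := exists_all_of_trans_fbeh hG hz
      have hT := hz.add_left (bangs s)
      rw [← h] at hT
      rcases trans_add_iff.1 hT with ⟨x, hx, heq⟩ | ⟨x, hx, heq⟩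
      · obtain ⟨H, hH, rfl⟩ := trans_bangs_iff.1 hx
        have hHF : fbeh G' = fbeh (.par H F) :=
          ih G'.size (by omega) hG' ⟨hs _ hH, hF⟩ (by rw [heq, fbeh_par, add_assoc]) rfl
        have := size_eq_of_fbeh_eq hHF
        simp only [FinProc.size] at this
        omega
      · obtain ⟨F', rfl, -, hF'⟩ := exists_all_of_trans_fbeh hF hx
        rwa [ih G'.size (by omega) hG' hF' heq rfl]

/-! ### Seeds -/

/-- The total size of a multiset of replicated prefixes. -/
def bangsSize (s : Multiset (Act × FinProc Act)) : ℕ := (s.map fun p => p.2.size + 1).sum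

theorem bangsSize_cons (p : Act × FinProc Act) (s : Multiset (Act × FinProc Act)) :
    bangsSize (p ::ₘ s) = p.2.size + 1 + bangsSize s := by
  rw [bangsSize, Multiset.map_cons, Multiset.sum_cons, bangsSize]

theorem size_toProc (F : FinProc Act) : F.toProc.size = F.size := by
  induction F with
  | nil => rfl
  | pre a F => rfl
  | par F G ihF ihG => simp only [FinProc.toProc, Proc.size, FinProc.size, ihF, ihG]

/-- Every process is a parallel composition of replicated prefixes and a finite process. -/
theorem Proc.exists_decomposition (P : Proc Act) :
    ∃ (s : Multiset (Act × FinProc Act)) (F : FinProc Act),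
      dcl P = (s.map fun p => dcl (.bang p.1 p.2)).sum + dcl F.toProc ∧
      beh P = bangs s + fbeh F ∧ P.size = bangsSize s + F.size := by
  induction P with
  | nil => exact ⟨0, .nil, (add_zero _).symm, (add_zero _).symm, rfl⟩
  | pre a F => exact ⟨0, .pre a F, (zero_add _).symm, (zero_add _).symm, (zero_add _).symm⟩
  | bang a F =>
    refine ⟨{(a, F)}, .nil, ?_, ?_, ?_⟩
    · rw [Multiset.map_singleton, Multiset.sum_singleton]
      exact (add_zero _).symm
    · rw [bangs, Multiset.map_singleton, Multiset.sum_singleton]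
      exact (add_zero _).symm
    · rw [bangsSize, Multiset.map_singleton, Multiset.sum_singleton]
      rfl
  | par P Q ihP ihQ =>
    obtain ⟨s, F, h1, h2, h3⟩ := ihP
    obtain ⟨t, G, h4, h5, h6⟩ := ihQ
    refine ⟨s + t, .par F G, ?_, ?_, ?_⟩
    · rw [dcl_par, h1, h4, Multiset.map_add, Multiset.sum_add, FinProc.toProc, dcl_par,
        add_add_add_comm]
    · rw [beh_par, h2, h5, bangs, bangs, bangs, Multiset.map_add, Multiset.sum_add, fbeh_par,
        add_add_add_comm]
    · rw [Proc.size, h3, h6, bangsSize, bangsSize, bangsSize, Multiset.map_add,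
        Multiset.sum_add, FinProc.size, add_add_add_comm]

theorem exists_proc_of_bangs_add (s : Multiset (Act × FinProc Act)) (F : FinProc Act) :
    ∃ P : Proc Act, beh P = bangs s + fbeh F ∧ P.size = bangsSize s + F.size := by
  induction s using Multiset.induction_on with
  | empty => exact ⟨F.toProc, (zero_add _).symm, (size_toProc F).trans (zero_add _).symm⟩
  | cons p s ih =>
    obtain ⟨P, h1, h2⟩ := ih
    refine ⟨.par (.bang p.1 p.2) P, ?_, ?_⟩
    · rw [beh_par, h1, bangs_cons, add_assoc]
    · rw [bangsSize_cons, Proc.size, h2, Proc.size, add_assoc (p.2.size + 1)]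

/-- The process given by `s` and `F` has minimal size up to bisimilarity. -/
def MinimalPair (s : Multiset (Act × FinProc Act)) (F : FinProc Act) : Prop :=
  ∀ t G, bangs t + fbeh G = bangs s + fbeh F → bangsSize s + F.size ≤ bangsSize t + G.size

theorem IsSeed.minimalPair {P : Proc Act} (h : IsSeed P) {s : Multiset (Act × FinProc Act)}
    {F : FinProc Act} (hbeh : beh P = bangs s + fbeh F) (hsize : P.size = bangsSize s + F.size) :
    MinimalPair s F := by
  obtain ⟨R, hRP, hmin⟩ := h
  intro t G htG
  obtain ⟨Q, hQ, hQsize⟩ := exists_proc_of_bangs_add t G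
  rw [← hsize, ← hQsize]
  exact hmin Q (hRP.trans (beh_eq_iff.1 (by rw [hbeh, hQ, htG])))

theorem nodup_map_of_forall_cons {α β : Type*} {f : α → β} {s : Multiset α}
    (h : ∀ p u, s = p ::ₘ u → f p ∉ u.map f) : (s.map f).Nodup := by
  induction s using Multiset.induction_on with
  | empty => exact Multiset.nodup_zero
  | cons p s ih =>
    rw [Multiset.map_cons, Multiset.nodup_cons]
    refine ⟨h p s rfl, ih ?_⟩
    rintro q u rfl hq
    refine h q (p ::ₘ u) (Multiset.cons_swap _ _ _) ?_
    rw [Multiset.map_cons]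
    exact Multiset.mem_cons_of_mem hq

namespace MinimalPair

variable {s t : Multiset (Act × FinProc Act)} {F G : FinProc Act}

theorem reduced (h : MinimalPair s F) : Reduced s F := by
  by_contra hF
  obtain ⟨G, h1, h2⟩ := exists_smaller_of_not_reduced hF
  have := h s G h1
  omega

theorem bangsSize_le (h : MinimalPair s F) (hst : bangs t = bangs s) :
    bangsSize s ≤ bangsSize t := by
  have := h t F (by rw [hst])
  omega

/-- A body that is not reduced has a smaller substitute modulo all of `bangs s`, its own replicated
prefix included, which is precisely what `bangs_cons_congr` requires. -/
theorem reduced_of_mem (h : MinimalPair s F) {p : Act × FinProc Act} (hp : p ∈ s) :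
    Reduced s p.2 := by
  by_contra hF
  obtain ⟨G, h1, h2⟩ := exists_smaller_of_not_reduced hF
  obtain ⟨s, rfl⟩ := Multiset.exists_cons_of_mem hp
  have := h.bangsSize_le (bangs_cons_congr h1.symm).symm
  rw [bangsSize_cons, bangsSize_cons] at this
  simp only at this
  omega

/-- A second replicated prefix with the same action and a bisimilar body could be deleted. -/
theorem nodup (h : MinimalPair s F) : (s.map fun p => (p.1, fbeh p.2)).Nodup := by
  refine nodup_map_of_forall_cons fun p u hu hmem => ?_
  subst hu
  obtain ⟨q, hq, hpq⟩ := Multiset.mem_map.1 hmem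
  obtain ⟨h1, h2⟩ := Prod.mk.inj hpq
  have hq' : (p.1, q.2) ∈ u := by rwa [← h1]
  have := h.bangsSize_le (bangs_cons_of_mem hq' h2.symm).symm
  rw [bangsSize_cons] at this
  omega

/-- Run `F` to exhaustion on the left, leaving `bangs s`. On the right, `bangs t` survives every
transition, while the rest evolves into an arbitrary behaviour, whence the generalisation over `g`.
-/
theorem exists_eq_add (heq : bangs s + fbeh F = bangs t + fbeh G) :
    ∃ g, bangs s = bangs t + g := by
  suffices ∀ g, bangs s + fbeh F = bangs t + g → ∃ g', bangs s = bangs t + g' from this _ heq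
  clear heq
  induction hn : F.size generalizing F with
  | zero =>
    intro g hg
    exact ⟨g, by rw [← hg, fbeh_eq_zero_of_size hn, add_zero]⟩
  | succ n ih =>
    intro g hg
    obtain ⟨a, y, hy⟩ := exists_trans_of_size_ne_zero (F := F) (by omega)
    obtain ⟨F', rfl, hF'⟩ := exists_of_trans_fbeh hy
    have hT := hy.add_left (bangs s)
    obtain ⟨g', hg'⟩ := exists_of_trans_bangs_add (hg ▸ hT)
    exact ih (by omega) g' hg'

/-- Each replicated part is the other plus something, so each absorbs the sum of both differences,
and antisymmetry applies. -/
theorem bangs_eq (heq : bangs s + fbeh F = bangs t + fbeh G) : bangs s = bangs t := by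
  obtain ⟨d, hd⟩ := exists_eq_add heq
  obtain ⟨e, he⟩ := exists_eq_add heq.symm
  refine eq_of_eq_add_of_eq_add (d := d) (e := e) ?_ ?_ (add_zero _).symm (add_zero _).symm hd he
  · rw [add_comm d, ← add_assoc, ← he, ← hd]
  · rw [← add_assoc, ← hd, ← he]

/-- Firing a replicated prefix of `s` is matched by one of `t` with the same action. The two bodies
agree modulo `bangs t` and are reduced, hence bisimilar. -/
theorem mem_map_of_mem (hs : MinimalPair s F) (ht : MinimalPair t G)
    (heq : bangs s = bangs t) {x : Act × Beh Act}
    (hx : x ∈ s.map fun p => (p.1, fbeh p.2)) : x ∈ t.map fun p => (p.1, fbeh p.2) := by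
  obtain ⟨⟨a, H⟩, hp, rfl⟩ := Multiset.mem_map.1 hx
  have hT : Trans (bangs s) a (bangs s + fbeh H) := trans_bangs_iff.2 ⟨H, hp, rfl⟩
  rw [heq] at hT
  obtain ⟨K, hK, hHK⟩ := trans_bangs_iff.1 hT
  have hred : ∀ E, Reduced s E ↔ Reduced t E := fun E => by rw [Reduced, Reduced, heq]
  have : fbeh H = fbeh K := fbeh_eq_of_reduced (fun p hp => ht.reduced_of_mem hp)
    ((hred H).1 (hs.reduced_of_mem hp)) (ht.reduced_of_mem hK) hHK
  exact Multiset.mem_map.2 ⟨(a, K), hK, by rw [this]⟩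

end MinimalPair

end MiniCCS

theorem mainTheorem2 {Act : Type u} (P P' : MiniCCS.Proc Act)
    (hP : MiniCCS.IsSeed P) (hP' : MiniCCS.IsSeed P') (h : MiniCCS.Bisim P P') :
    MiniCCS.EqD P P' := by
  obtain ⟨s, F, h1, h2, h3⟩ := P.exists_decomposition
  obtain ⟨t, G, h4, h5, h6⟩ := P'.exists_decomposition
  have hs := hP.minimalPair h2 h3
  have ht := hP'.minimalPair h5 h6
  have heq : MiniCCS.bangs s + MiniCCS.fbeh F = MiniCCS.bangs t + MiniCCS.fbeh G := by
    rw [← h2, ← h5, MiniCCS.beh_eq_iff.2 h]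
  have hst := MiniCCS.MinimalPair.bangs_eq heq
  have hmap : s.map (fun p => (p.1, MiniCCS.fbeh p.2)) =
      t.map fun p => (p.1, MiniCCS.fbeh p.2) :=
    -- Transitions only reveal which bodies occur; absence of repetitions upgrades this to equality
    -- of multisets.
    (Multiset.Nodup.ext hs.nodup ht.nodup).2 fun _ =>
      ⟨hs.mem_map_of_mem ht hst, ht.mem_map_of_mem hs hst.symm⟩
  have hFG : MiniCCS.fbeh F = MiniCCS.fbeh G := by
    refine MiniCCS.fbeh_eq_of_reduced (fun p hp => hs.reduced_of_mem hp) hs.reduced ?_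
      (heq.trans (by rw [hst]))
    have := ht.reduced
    rwa [MiniCCS.Reduced, ← hst] at this
  refine MiniCCS.dcl_eq_iff.1 ?_
  rw [h1, h4, MiniCCS.dcl_eq_iff.2 (MiniCCS.eqD_of_fbeh_eq hFG)]
  congr 1
  refine MiniCCS.sum_map_eq_of_map_eq hmap ?_
  rintro ⟨a, H⟩ ⟨b, K⟩ - hHK
  obtain ⟨rfl, hHK'⟩ := Prod.mk.inj hHK
  exact MiniCCS.dcl_eq_iff.2 (.bang _ (MiniCCS.eqD_of_fbeh_eq hHK'))
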